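/- Let $X\neq\{0\}$ be a complex Banach space that is finite-dimensional or a Hilbert space, let $E=\ell^2(\mathbb Z,X)$ with norm $\|x\|=(\sum_{j\in\mathbb Z}\|x_j\|_X^2)^{1/2}$, and let $L(E)$ be the space of bounded linear operators on $E$. **Notation.** Every $B\in L(E)$ has a matrix representation $[b_{i,j}]_{i,j\in\mathbb Z}$, $b_{i,j}\in L(X)$, where $b_{i,j}x$ is the $i$-th entry of $B$ applied to the sequence with $j$-th entry $x$ and all other entries $0$. $B$ is banded with band-width $w$ if $b_{i,j}=0$ whenever $|i-j|>w$, and tridiagonal if it is banded with band-width $1$; $BO(E)$ is the set of all banded operators, and $BDO(E)$, the set of band-dominated operators, is its closure in the operator norm. With the conventions $\|B^{-1}\|:=\infty$ if $B$ is not invertible and $1/\infty:=0$, put $\mathrm{Spec}_\varepsilon B:=\{\lambda\in\mathbb C: 1/\|(B-\lambda I)^{-1}\|\le\varepsilon\}$ for $\varepsilon>0$ and $\mathrm{Spec}_0B:=\mathrm{Spec}\,B$. The lower norm of an operator $C$ is $\nu(C):=\inf_{\|x\|=1}\|Cx\|$. Let $B^*$ be the Banach space adjoint of $B$, acting on $E^*=\ell^2(\mathbb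 Z,X^*)$, and for $n\in\mathbb N=\{1,2,\dots\}$, $k\in\mathbb Z$ let $E_{n,k}$ be the subspace of sequences (in $E$, respectively in $E^*$) supported in $\{k+1,\dots,k+n\}$. Put $$\mu_n(B):=\inf_{k\in\mathbb Z}\min\big(\nu(B|_{E_{n,k}}),\nu(B^*|_{E_{n,k}})\big),\qquad \Gamma^n_\varepsilon(B):=\{\lambda\in\mathbb C:\mu_n(B-\lambda I)\le\varepsilon\}\quad(\varepsilon\ge0),$$ $$r(B):=\sup_{i\in\mathbb Z}\|b_{i+1,i}\|+\sup_{i\in\mathbb Z}\|b_{i-1,i}\|,\qquad \varepsilon''_n(B):=2\,r(B)\sin\frac{\pi}{2(n+1)}.$$ For $b\in\mathbb N$ give $X^b$ the norm $(\sum_{j=1}^b\|\xi_j\|_X^2)^{1/2}$ and let $\mathcal I_b:\ell^2(\mathbb Z,X)\to\ell^2(\mathbb Z,X^b)$ be the isometric isomorphism $x\mapsto\xi$, $\xi_i=(x_{bi+1},\dots,x_{b(i+1)})$. The notions above are used in the same way for operators on $\ell^2(\mathbb Z,X^b)$. For non-empty bounded $S_n,S\subset\mathbb C$, write $S_n\to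 S$ in the Hausdorff sense if $\max\big(\sup_{s\in S_n}\mathrm{dist}(s,S),\sup_{s\in S}\mathrm{dist}(s,S_n)\big)\to0$ as $n\to\infty$. **Theorem.** Let $A\in BDO(E)$, let $(A^{(n)})_{n\in\mathbb N}\subset BO(E)$ be such that $\delta_n:=\|A-A^{(n)}\|\to0$ as $n\to\infty$, let $w_n\ge1$ be a band-width of $A^{(n)}$, and let $A_n:=\mathcal I_{w_n}A^{(n)}\mathcal I_{w_n}^{-1}$. Then $A_n$ is tridiagonal for every $n\in\mathbb N$, and, for every $\varepsilon\ge0$ and $n\in\mathbb N$, $$\mathrm{Spec}_\varepsilon A\ \subset\ \Gamma^n_{\varepsilon+\delta_n+\varepsilon''_n(A_n)}(A_n)\ \subset\ \mathrm{Spec}_{\varepsilon+2\delta_n+\varepsilon''_n(A_n)}A.$$ Moreover, for every $\varepsilon\ge0$, the sets involved are non-empty and bounded and $\Gamma^n_{\varepsilon+\delta_n+\varepsilon''_n(A_n)}(A_n)\to\mathrm{Spec}_\varepsilon A$ in the Hausdorff sense as $n\to\infty$; in particular $\Gamma^n_{\delta_n+\varepsilon''_n(A_n)}(A_n)\to\mathrm{Spec}\,A$.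 -/

import Mathlib

open Filter Topology

noncomputable section

namespace BandDominated

/-! ### The spectrum, closed pseudospectra and the lower norm -/

section Pseudospectra

variable {Y Z : Type*} [NormedAddCommGroup Y] [NormedSpace ℂ Y]
  [NormedAddCommGroup Z] [NormedSpace ℂ Z]

open Classical in
/-- `1 / ‖B⁻¹‖`, with the convention that this is `0` if `B` is not invertible. -/
def recipNormInv (B : Y →L[ℂ] Y) : ℝ :=
  if IsUnit B then 1 / ‖Ring.inverse B‖ else 0

open Classical in
/-- The closed `ε`-pseudospectrum: `{λ : 1 / ‖(B - λ I)⁻¹‖ ≤ ε}` for `ε > 0`, and the spectrum of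
`B` for `ε = 0` (only `ε ≥ 0` is meaningful). -/
def Specc (ε : ℝ) (B : Y →L[ℂ] Y) : Set ℂ :=
  if 0 < ε then {z : ℂ | recipNormInv (B - z • ContinuousLinearMap.id ℂ Y) ≤ ε}
  else spectrum ℂ B

/-- The lower norm `ν(B) = inf {‖B x‖ : ‖x‖ = 1}` (the domain is meant to be nontrivial). -/
def lowerNorm (B : Y →L[ℂ] Z) : ℝ :=
  ⨅ x : {x : Y // ‖x‖ = 1}, ‖B x‖

end Pseudospectra

/-- Hausdorff convergence `S n → T` of non-empty bounded subsets of `ℂ` as `n → ∞`. For such sets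
`Metric.hausdorffDist` is the maximum of the two one-sided suprema of distances. -/
def HausdorffTendsto (S : ℕ+ → Set ℂ) (T : Set ℂ) : Prop :=
  (∀ n, (S n).Nonempty ∧ Bornology.IsBounded (S n)) ∧ T.Nonempty ∧ Bornology.IsBounded T ∧
    Tendsto (fun n => Metric.hausdorffDist (S n) T) atTop (𝓝 0)

/-! ### The space `ℓ²(ℤ, X)` and matrix representations -/

/-- `ℓ²(ℤ, X)`. -/
abbrev EllTwo (X : Type*) [NormedAddCommGroup X] := lp (fun _ : ℤ => X) 2

section Blocks

variable {X : Type*} [NormedAddCommGroup X]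

/-! ### Rewriting in tridiagonal block form -/

/-- `X^b` with the norm `(∑ j, ‖ξ_j‖²)^(1/2)`. -/
def Pow (X : Type*) [NormedAddCommGroup X] (b : ℕ) : Type _ := PiLp 2 (fun _ : Fin b => X)

namespace Pow

instance (b : ℕ) : NormedAddCommGroup (Pow X b) :=
  inferInstanceAs (NormedAddCommGroup (PiLp 2 (fun _ : Fin b => X)))

instance [NormedSpace ℂ X] (b : ℕ) : NormedSpace ℂ (Pow X b) :=
  inferInstanceAs (NormedSpace ℂ (PiLp 2 (fun _ : Fin b => X)))

instance [CompleteSpace X] (b : ℕ) : CompleteSpace (Pow X b) :=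
  inferInstanceAs (CompleteSpace (PiLp 2 (fun _ : Fin b => X)))

/-- The vector `(v_0, …, v_{b-1}) ∈ X^b`. -/
def mk {b : ℕ} (v : Fin b → X) : Pow X b := WithLp.toLp 2 v

/-- The components of a vector in `X^b`. -/
def get {b : ℕ} (ξ : Pow X b) : Fin b → X := WithLp.ofLp (p := 2) ξ

lemma norm_sq_eq {b : ℕ} (ξ : Pow X b) : ‖ξ‖ ^ 2 = ∑ m, ‖ξ.get m‖ ^ 2 :=
  PiLp.norm_sq_eq_of_L2 (fun _ : Fin b => X) ξ

end Pow

/-- The bijection `(i, m) ↦ b i + 1 + m`, where `m = 0, …, b - 1`. -/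
def blockIndex (b : ℕ) [NeZero b] : ℤ × Fin b ≃ ℤ :=
  (Int.divModEquiv b).symm.trans (Equiv.addRight 1)

lemma blockIndex_apply (b : ℕ) [NeZero b] (i : ℤ) (m : Fin b) :
    blockIndex b (i, m) = (b : ℤ) * i + 1 + (m : ℕ) := by
  simp [blockIndex, Int.divModEquiv]
  ring

/-- The sequence `ξ` with `ξ_i = (x_{b i + 1}, …, x_{b (i + 1)})`. -/
def blockSeq (b : ℕ) [NeZero b] (x : ℤ → X) (i : ℤ) : Pow X b :=
  Pow.mk fun m => x (blockIndex b (i, m))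

/-- The inverse of `blockSeq`: the entries of all blocks in order. -/
def unblockSeq (b : ℕ) [NeZero b] (ξ : ℤ → Pow X b) (j : ℤ) : X :=
  (ξ ((blockIndex b).symm j).1).get ((blockIndex b).symm j).2

lemma unblockSeq_blockSeq (b : ℕ) [NeZero b] (x : ℤ → X) : unblockSeq b (blockSeq b x) = x := by
  funext j
  change x (blockIndex b ((blockIndex b).symm j)) = x j
  rw [Equiv.apply_symm_apply]

lemma blockSeq_unblockSeq (b : ℕ) [NeZero b] (ξ : ℤ → Pow X b) :
    blockSeq b (unblockSeq b ξ) = ξ := by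
  funext i
  have h : ∀ m, unblockSeq b ξ (blockIndex b (i, m)) = (ξ i).get m := fun m => by
    rw [unblockSeq, Equiv.symm_apply_apply]
  simp only [blockSeq, h]
  rfl

lemma norm_blockSeq_sq (b : ℕ) [NeZero b] (x : ℤ → X) (i : ℤ) :
    ‖blockSeq b x i‖ ^ 2 = ∑ m, ‖x (blockIndex b (i, m))‖ ^ 2 :=
  Pow.norm_sq_eq _

lemma summable_blockSeq_iff (b : ℕ) [NeZero b] (x : ℤ → X) :
    (Summable fun i => ‖blockSeq b x i‖ ^ 2) ↔ Summable fun j => ‖x j‖ ^ 2 := by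
  rw [← (blockIndex b).summable_iff (f := fun j => ‖x j‖ ^ 2)]
  simp_rw [norm_blockSeq_sq]
  rw [summable_prod_of_nonneg (fun _ => by dsimp only [Function.comp, Pi.zero_apply]; positivity)]
  simp only [Function.comp_apply, tsum_fintype]
  exact ⟨fun h => ⟨fun _ => Summable.of_finite, h⟩, fun h => h.2⟩

lemma tsum_blockSeq (b : ℕ) [NeZero b] (x : ℤ → X) (hx : Summable fun j => ‖x j‖ ^ 2) :
    ∑' i, ‖blockSeq b x i‖ ^ 2 = ∑' j, ‖x j‖ ^ 2 := by
  have h0 : Summable fun c : ℤ × Fin b => ‖x (blockIndex b c)‖ ^ 2 :=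
    ((blockIndex b).summable_iff (f := fun j => ‖x j‖ ^ 2)).2 hx
  have h1 : ∑' c : ℤ × Fin b, ‖x (blockIndex b c)‖ ^ 2 = ∑' j, ‖x j‖ ^ 2 :=
    (blockIndex b).tsum_eq fun j => ‖x j‖ ^ 2
  rw [← h1, h0.tsum_prod]
  refine tsum_congr fun i => ?_
  rw [norm_blockSeq_sq, tsum_fintype]

end Blocks

section EllTwo

variable {X : Type*} [NormedAddCommGroup X]

lemma memℓp_two_iff {ι : Type*} {V : Type*} [NormedAddCommGroup V] (f : ι → V) :
    Memℓp f 2 ↔ Summable fun i => ‖f i‖ ^ 2 := by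
  rw [memℓp_gen_iff (by norm_num)]
  simp

lemma norm_sq_eq_tsum (x : EllTwo X) : ‖x‖ ^ 2 = ∑' i, ‖x i‖ ^ 2 := by
  have := lp.norm_rpow_eq_tsum (p := 2) (by norm_num) x
  simpa using this

lemma summable_norm_sq (x : EllTwo X) : Summable fun i => ‖x i‖ ^ 2 :=
  (memℓp_two_iff _).1 (lp.memℓp x)

lemma norm_sum_single_sq (x : ℤ → X) (F : Finset ℤ) :
    ‖∑ i ∈ F, (lp.single 2 i (x i) : EllTwo X)‖ ^ 2 = ∑ i ∈ F, ‖x i‖ ^ 2 := by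
  have := lp.norm_sum_single (E := fun _ : ℤ => X) (p := 2) (by norm_num) x F
  simpa using this

variable [NormedSpace ℂ X]

/-- The coordinate functional `x ↦ x i` on `ℓ²(ℤ, X)`. -/
def coord (i : ℤ) : EllTwo X →L[ℂ] X :=
  LinearMap.mkContinuous
    { toFun := fun x => x i
      map_add' := fun _ _ => rfl
      map_smul' := fun _ _ => rfl } 1
    (fun x => by
      rw [one_mul]
      exact lp.norm_apply_le_norm (by norm_num) x i)

/-- The sequence with `i`-th entry `x` and all other entries zero. -/
def single (i : ℤ) : X →L[ℂ] EllTwo X :=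
  lp.singleContinuousLinearMap ℂ (fun _ : ℤ => X) 2 i

/-- The entry `a_{i,j} ∈ L(X)` of the matrix representation of `A ∈ L(ℓ²(ℤ, X))`. -/
def entry (A : EllTwo X →L[ℂ] EllTwo X) (i j : ℤ) : X →L[ℂ] X :=
  (coord i).comp (A.comp (single j))

/-- `A` is banded with band-width `w`: `a_{i,j} = 0` whenever `|i - j| > w`. -/
def IsBandedWith (A : EllTwo X →L[ℂ] EllTwo X) (w : ℕ) : Prop :=
  ∀ i j : ℤ, (w : ℤ) < |i - j| → entry A i j = 0

variable (X) in
/-- `BO(E)`: the banded operators on `E = ℓ²(ℤ, X)`. -/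
def BO : Set (EllTwo X →L[ℂ] EllTwo X) := {A | ∃ w : ℕ, IsBandedWith A w}

variable (X) in
/-- `BDO(E)`: the band-dominated operators, the operator norm closure of `BO(E)`. -/
def BDO : Set (EllTwo X →L[ℂ] EllTwo X) := closure (BO X)

/-- The subspace `E_{n,k}` of sequences supported in `{k + 1, …, k + n}`. -/
def window (X : Type*) [NormedAddCommGroup X] [NormedSpace ℂ X] (n : ℕ) (k : ℤ) :
    Submodule ℂ (EllTwo X) where
  carrier := {x | ∀ j : ℤ, ¬ (k + 1 ≤ j ∧ j ≤ k + n) → x j = 0}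
  add_mem' := fun {x y} hx hy j hj => by
    simp [hx j hj, hy j hj]
  zero_mem' := fun _ _ => rfl
  smul_mem' := fun c x hx j hj => by
    simp [hx j hj]

/-! ### The Banach space adjoint, realised on `ℓ²(ℤ, X*)` -/

/-- The restriction of a functional on `ℓ²(ℤ, X)` to the `i`-th coordinate. -/
def dualEntry (f : StrongDual ℂ (EllTwo X)) (i : ℤ) : StrongDual ℂ X := f.comp (single i)

lemma dualEntry_apply (f : StrongDual ℂ (EllTwo X)) (i : ℤ) (x : X) :
    dualEntry f i x = f (lp.single 2 i x) := rfl

lemma exists_almost_norming (g : StrongDual ℂ X) {η : ℝ} (hη : 0 < η) :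
    ∃ x : X, ‖x‖ ≤ ‖g‖ ∧ ‖g‖ ^ 2 - η ≤ (g x).re := by
  rcases (norm_nonneg g).eq_or_lt with h0 | h0
  · exact ⟨0, by simp, by rw [← h0]; simp [hη.le]⟩
  · have hr : ‖g‖ - η / ‖g‖ < ‖g‖ := by
      have := div_pos hη h0
      linarith
    obtain ⟨x, hx1, hx2⟩ := g.exists_lt_apply_of_lt_opNorm hr
    obtain ⟨c, hc, hcx⟩ := RCLike.exists_norm_eq_mul_self (g x)
    refine ⟨((‖g‖ : ℝ) : ℂ) • c • x, ?_, ?_⟩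
    · rw [norm_smul, norm_smul, hc, Complex.norm_real, norm_norm, one_mul]
      nlinarith [norm_nonneg x]
    · have h1 : g (((‖g‖ : ℝ) : ℂ) • c • x) = ((‖g‖ * ‖g x‖ : ℝ) : ℂ) := by
        rw [map_smul, map_smul, smul_eq_mul, smul_eq_mul, ← hcx]
        push_cast
        rfl
      rw [h1, Complex.ofReal_re]
      have h2 : ‖g‖ * (‖g‖ - η / ‖g‖) = ‖g‖ ^ 2 - η := by
        field_simp
      rw [← h2]
      exact mul_le_mul_of_nonneg_left hx2.le h0.le

lemma sum_norm_dualEntry_sq_le (f : StrongDual ℂ (EllTwo X)) (F : Finset ℤ) :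
    ∑ i ∈ F, ‖dualEntry f i‖ ^ 2 ≤ ‖f‖ ^ 2 := by
  set S := ∑ i ∈ F, ‖dualEntry f i‖ ^ 2 with hS
  have hS0 : 0 ≤ S := Finset.sum_nonneg fun _ _ => by positivity
  have key : ∀ η : ℝ, 0 < η → S ≤ ‖f‖ * √S + F.card * η := by
    intro η hη
    choose x hx1 hx2 using fun i => exists_almost_norming (dualEntry f i) hη
    have h1 : S - F.card * η ≤ (f (∑ i ∈ F, (lp.single 2 i (x i) : EllTwo X))).re := by
      rw [map_sum, Complex.re_sum, hS]
      calc ∑ i ∈ F, ‖dualEntry f i‖ ^ 2 - F.card * η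
          = ∑ i ∈ F, (‖dualEntry f i‖ ^ 2 - η) := by simp
        _ ≤ ∑ i ∈ F, (f (lp.single 2 i (x i))).re := Finset.sum_le_sum fun i _ => hx2 i
    have h2 : ‖∑ i ∈ F, (lp.single 2 i (x i) : EllTwo X)‖ ≤ √S := by
      apply Real.le_sqrt_of_sq_le
      rw [norm_sum_single_sq, hS]
      exact Finset.sum_le_sum fun i _ => pow_le_pow_left₀ (norm_nonneg _) (hx1 i) 2
    have h3 := (Complex.re_le_norm _).trans
      (f.le_opNorm (∑ i ∈ F, (lp.single 2 i (x i) : EllTwo X)))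
    have h4 := mul_le_mul_of_nonneg_left h2 (norm_nonneg f)
    linarith
  have key2 : S ≤ ‖f‖ * √S := by
    refine le_of_forall_pos_le_add fun ε hε => ?_
    refine (key (ε / (F.card + 1)) (by positivity)).trans ?_
    have : (F.card : ℝ) * (ε / (F.card + 1)) ≤ ε := by
      rw [mul_div_assoc', div_le_iff₀ (by positivity)]
      nlinarith
    linarith
  have h5 : √S ^ 2 = S := Real.sq_sqrt hS0
  have h6 : √S ≤ ‖f‖ := by
    rcases (Real.sqrt_nonneg S).eq_or_lt with h | h
    · rw [← h]; exact norm_nonneg f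
    · nlinarith
  rw [← h5]
  exact pow_le_pow_left₀ (Real.sqrt_nonneg S) h6 2

lemma pairing_bound (φ : EllTwo (StrongDual ℂ X)) (x : EllTwo X) :
    Summable (fun i => ‖φ i (x i)‖) ∧ ∑' i, ‖φ i (x i)‖ ≤ ‖φ‖ * ‖x‖ := by
  have hx := summable_norm_sq x
  have hφ := summable_norm_sq φ
  have h1 := Real.summable_and_inner_le_Lp_mul_Lq_tsum_of_nonneg Real.HolderConjugate.two_two
    (f := fun i => ‖φ i‖) (g := fun i => ‖x i‖) (fun _ => norm_nonneg _) (fun _ => norm_nonneg _)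
    (by simpa using hφ) (by simpa using hx)
  have h2 : ∑' i, ‖φ i‖ * ‖x i‖ ≤ ‖φ‖ * ‖x‖ := by
    refine h1.2.trans_eq ?_
    rw [lp.norm_eq_tsum_rpow (by norm_num) φ, lp.norm_eq_tsum_rpow (by norm_num) x]
    simp
  have hle : ∀ i, ‖φ i (x i)‖ ≤ ‖φ i‖ * ‖x i‖ := fun i => (φ i).le_opNorm (x i)
  have hs := Summable.of_nonneg_of_le (fun i => norm_nonneg (φ i (x i))) hle h1.1
  exact ⟨hs, (hs.tsum_le_tsum hle h1.1).trans h2⟩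

/-- The functional `x ↦ ∑ i, φ_i(x_i)` on `ℓ²(ℤ, X)` given by `φ ∈ ℓ²(ℤ, X*)`. -/
def pairing (φ : EllTwo (StrongDual ℂ X)) : StrongDual ℂ (EllTwo X) :=
  LinearMap.mkContinuous
    { toFun := fun x => ∑' i, φ i (x i)
      map_add' := fun x y => by
        have h : ∀ i, φ i ((x + y) i) = φ i (x i) + φ i (y i) := fun i => by simp
        simp_rw [h]
        exact (pairing_bound φ x).1.of_norm.tsum_add (pairing_bound φ y).1.of_norm
      map_smul' := fun c x => by
        have h : ∀ i, φ i ((c • x) i) = c • φ i (x i) := fun i => by simp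
        simp_rw [h]
        exact (pairing_bound φ x).1.of_norm.tsum_const_smul c } ‖φ‖
    (fun x => (norm_tsum_le_tsum_norm (pairing_bound φ x).1).trans (pairing_bound φ x).2)

lemma pairing_apply (φ : EllTwo (StrongDual ℂ X)) (x : EllTwo X) :
    pairing φ x = ∑' i, φ i (x i) := rfl

lemma dualEntry_pairing (φ : EllTwo (StrongDual ℂ X)) (i : ℤ) :
    dualEntry (pairing φ) i = φ i := by
  ext x
  rw [dualEntry_apply, pairing_apply, tsum_eq_single i]
  · simp
  · intro j hj
    simp [lp.single_apply, Pi.single_eq_of_ne hj]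

lemma memℓp_dualEntry (f : StrongDual ℂ (EllTwo X)) : Memℓp (dualEntry f) 2 :=
  (memℓp_two_iff _).2
    (summable_of_sum_le (fun _ => by positivity) (sum_norm_dualEntry_sq_le f))

lemma pairing_dualEntry (f : StrongDual ℂ (EllTwo X)) :
    pairing (⟨dualEntry f, memℓp_dualEntry f⟩ : EllTwo (StrongDual ℂ X)) = f := by
  ext x
  have h := (lp.hasSum_single (p := 2) (by norm_num) x).mapL f
  rw [pairing_apply, ← h.tsum_eq]
  rfl

lemma norm_pairing_le (φ : EllTwo (StrongDual ℂ X)) : ‖pairing φ‖ ≤ ‖φ‖ :=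
  LinearMap.mkContinuous_norm_le _ (norm_nonneg _) _

/-- The isometric isomorphism of the dual space of `ℓ²(ℤ, X)` with `ℓ²(ℤ, X*)`, mapping a
functional to the sequence of its restrictions to the coordinates; the inverse maps `φ` to
`x ↦ ∑ i, φ_i(x_i)`. -/
def dualIso (X : Type*) [NormedAddCommGroup X] [NormedSpace ℂ X] :
    StrongDual ℂ (EllTwo X) ≃ₗᵢ[ℂ] EllTwo (StrongDual ℂ X) where
  toFun f := ⟨dualEntry f, memℓp_dualEntry f⟩
  invFun φ := pairing φ
  map_add' _ _ := rfl
  map_smul' _ _ := rfl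
  left_inv f := pairing_dualEntry f
  right_inv φ := by
    ext1
    funext i
    exact dualEntry_pairing φ i
  norm_map' f := by
    refine le_antisymm ?_ ?_
    · refine (sq_le_sq₀ (norm_nonneg _) (norm_nonneg f)).1 ?_
      rw [norm_sq_eq_tsum]
      exact Real.tsum_le_of_sum_le (fun _ => by positivity) (sum_norm_dualEntry_sq_le f)
    · have h := norm_pairing_le (⟨dualEntry f, memℓp_dualEntry f⟩ : EllTwo (StrongDual ℂ X))
      rw [pairing_dualEntry] at h
      exact h

/-- The Banach space adjoint `A* : f ↦ f ∘ A` of `A`, as an operator on `ℓ²(ℤ, X*)`. -/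
def adjoint (A : EllTwo X →L[ℂ] EllTwo X) :
    EllTwo (StrongDual ℂ X) →L[ℂ] EllTwo (StrongDual ℂ X) :=
  ((dualIso X).toContinuousLinearEquiv : StrongDual ℂ (EllTwo X) →L[ℂ] EllTwo (StrongDual ℂ X)).comp
    (((ContinuousLinearMap.compL ℂ (EllTwo X) (EllTwo X) ℂ).flip A).comp
      ((dualIso X).symm.toContinuousLinearEquiv :
        EllTwo (StrongDual ℂ X) →L[ℂ] StrongDual ℂ (EllTwo X)))

/-! ### The one-sided truncation (`τ₁`) method -/

/-- `μ_n(B) = inf_k min (ν(B|_{E_{n,k}}), ν(B*|_{E_{n,k}}))`, where for `B*` the subspace `E_{n,k}`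
is the one of `ℓ²(ℤ, X*)`. -/
def muTrunc (n : ℕ) (B : EllTwo X →L[ℂ] EllTwo X) : ℝ :=
  ⨅ k : ℤ, min (lowerNorm (B.comp (window X n k).subtypeL))
    (lowerNorm ((adjoint B).comp (window (StrongDual ℂ X) n k).subtypeL))

/-- `Γ^n_ε(A) = {λ : μ_n(A - λ I) ≤ ε}`. -/
def Gam (n : ℕ) (ε : ℝ) (A : EllTwo X →L[ℂ] EllTwo X) : Set ℂ :=
  {z : ℂ | muTrunc n (A - z • ContinuousLinearMap.id ℂ (EllTwo X)) ≤ ε}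

/-- `r(A) = sup_i ‖a_{i+1,i}‖ + sup_i ‖a_{i-1,i}‖`. -/
def rBound (A : EllTwo X →L[ℂ] EllTwo X) : ℝ :=
  (⨆ i : ℤ, ‖entry A (i + 1) i‖) + ⨆ i : ℤ, ‖entry A (i - 1) i‖

/-- The truncation penalty `ε''_n(A) = 2 r(A) sin (π / (2 (n + 1)))`. -/
def penalty (n : ℕ) (A : EllTwo X →L[ℂ] EllTwo X) : ℝ :=
  2 * rBound A * Real.sin (Real.pi / (2 * ((n : ℝ) + 1)))

/-- The isometric isomorphism `𝓘_b : ℓ²(ℤ, X) → ℓ²(ℤ, X^b)`, `x ↦ ξ` with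
`ξ_i = (x_{b i + 1}, …, x_{b (i + 1)})`. -/
def blockIso (X : Type*) [NormedAddCommGroup X] [NormedSpace ℂ X] (b : ℕ) [NeZero b] :
    EllTwo X ≃ₗᵢ[ℂ] EllTwo (Pow X b) where
  toFun x := ⟨blockSeq b x,
    (memℓp_two_iff _).2 ((summable_blockSeq_iff b _).2 (summable_norm_sq x))⟩
  invFun ξ := ⟨unblockSeq b ξ, (memℓp_two_iff _).2 ((summable_blockSeq_iff b _).1 (by
    rw [blockSeq_unblockSeq]
    exact summable_norm_sq ξ))⟩
  map_add' _ _ := rfl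
  map_smul' _ _ := rfl
  left_inv x := Subtype.ext (unblockSeq_blockSeq b x)
  right_inv ξ := Subtype.ext (blockSeq_unblockSeq b ξ)
  norm_map' x := by
    refine (sq_eq_sq₀ (norm_nonneg _) (norm_nonneg _)).1 ?_
    rw [norm_sq_eq_tsum, norm_sq_eq_tsum]
    exact tsum_blockSeq b x (summable_norm_sq x)

/-- `𝓘_b A 𝓘_b⁻¹`, an operator on `ℓ²(ℤ, X^b)`. -/
def blockForm (b : ℕ) [NeZero b] (A : EllTwo X →L[ℂ] EllTwo X) :
    EllTwo (Pow X b) →L[ℂ] EllTwo (Pow X b) :=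
  ((blockIso X b).toContinuousLinearEquiv : EllTwo X →L[ℂ] EllTwo (Pow X b)).comp
    (A.comp ((blockIso X b).symm.toContinuousLinearEquiv : EllTwo (Pow X b) →L[ℂ] EllTwo X))

end EllTwo

/-- The given norm on the complex Banach space `X` is a Hilbert space norm: it comes from an inner
product compatible with the given vector space structure. -/
def IsHilbertNorm (X : Type*) [NormedAddCommGroup X] [inst : NormedSpace ℂ X] : Prop :=
  ∃ ip : @InnerProductSpace ℂ X _ _, @InnerProductSpace.toNormedSpace ℂ X _ _ ip = inst

end BandDominated

end

open BandDominated

/-! For every operator B on ℓ² the number 1/‖B⁻¹‖, read as 0 when B is not invertible, equals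
min(ν(B), ν(B*)) (`recipNormInv_eq_min`). Lower norms are infima over unit vectors. Hence 1/‖B⁻¹‖ is
1-Lipschitz in B, and it can only grow when vectors are confined to a window: 1/‖B⁻¹‖ ≤ μ_n(B).

The converse for tridiagonal B, μ_n(B) ≤ 1/‖B⁻¹‖ + ε''_n(B), is the heart of the proof
(`exists_lowerNorm_window_le`). Take an almost minimising unit vector x and multiply it by all
translates of a weight w supported in {1, …, n}. The commutator of B with such a weight involves
only the first differences of w and the two off-diagonals of B. Summing squares over all translates
decouples w from x, so some translate is at least as good as the average. The discrete sine, the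
ground state of the Dirichlet Laplacian, gives differences of relative size 2 sin(π/(2(n+1))),
whence the penalty. The adjoint is tridiagonal too, with the off-diagonal bounds exchanged.

Blocking is an isometric conjugation, so it preserves 1/‖·⁻¹‖ and makes A^(n) tridiagonal. Passing
between A and A^(n) costs δ_n each way, which gives both inclusions. The penalties tend to 0 because
r(A_n) ≤ 2‖A^(n)‖ stays bounded however large the blocks become; Hausdorff convergence then follows
since, by compactness, closed pseudospectra depend on ε continuously from the right. -/

open Filter Topology

noncomputable section

namespace BandDominated

/-! ### Lower norms and the reciprocal of the norm of the inverse -/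

section LowerNorm

variable {V W : Type*} [NormedAddCommGroup V] [NormedSpace ℂ V]
  [NormedAddCommGroup W] [NormedSpace ℂ W]

lemma bddBelow_lowerNorm (B : V →L[ℂ] W) :
    BddBelow (Set.range fun x : {x : V // ‖x‖ = 1} => ‖B x‖) :=
  ⟨0, by rintro _ ⟨x, rfl⟩; exact norm_nonneg _⟩

lemma lowerNorm_nonneg (B : V →L[ℂ] W) : 0 ≤ lowerNorm B :=
  Real.iInf_nonneg fun _ => norm_nonneg _

lemma lowerNorm_mul_norm_le (B : V →L[ℂ] W) (x : V) : lowerNorm B * ‖x‖ ≤ ‖B x‖ := by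
  rcases eq_or_ne x 0 with rfl | hx
  · simp
  have hx' : 0 < ‖x‖ := norm_pos_iff.2 hx
  have h1 : ‖(((‖x‖⁻¹ : ℝ) : ℂ)) • x‖ = 1 := by
    rw [norm_smul, Complex.norm_real, norm_inv, norm_norm, inv_mul_cancel₀ hx'.ne']
  have h2 : lowerNorm B ≤ ‖B ((((‖x‖⁻¹ : ℝ) : ℂ)) • x)‖ :=
    ciInf_le (bddBelow_lowerNorm B) ⟨_, h1⟩
  rw [map_smul, norm_smul, Complex.norm_real, norm_inv, norm_norm, ← div_eq_inv_mul,
    le_div_iff₀ hx'] at h2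
  exact h2

lemma nonempty_unit_sphere [Nontrivial V] : Nonempty {x : V // ‖x‖ = 1} := by
  obtain ⟨x, hx⟩ := exists_norm_eq V (zero_le_one' ℝ)
  exact ⟨⟨x, hx⟩⟩

lemma le_lowerNorm [Nontrivial V] {B : V →L[ℂ] W} {c : ℝ} (h : ∀ x, c * ‖x‖ ≤ ‖B x‖) :
    c ≤ lowerNorm B := by
  have := nonempty_unit_sphere (V := V)
  refine le_ciInf fun x => ?_
  simpa [x.2] using h x

lemma exists_norm_lt_of_lowerNorm_lt [Nontrivial V] {B : V →L[ℂ] W} {c : ℝ}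
    (h : lowerNorm B < c) : ∃ x, ‖x‖ = 1 ∧ ‖B x‖ < c := by
  have := nonempty_unit_sphere (V := V)
  obtain ⟨x, hx⟩ := exists_lt_of_ciInf_lt h
  exact ⟨x, x.2, hx⟩

lemma lowerNorm_le_add [Nontrivial V] (B C : V →L[ℂ] W) :
    lowerNorm B ≤ lowerNorm C + ‖B - C‖ := by
  rw [← sub_le_iff_le_add]
  refine le_lowerNorm fun x => ?_
  have h1 := lowerNorm_mul_norm_le B x
  have h2 := (B - C).le_opNorm x
  have h3 : ‖B x‖ ≤ ‖C x‖ + ‖(B - C) x‖ := by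
    have := norm_add_le (C x) ((B - C) x)
    simpa using this
  linarith

lemma lowerNorm_le_comp_subtypeL (B : V →L[ℂ] W) (p : Submodule ℂ V) [Nontrivial p] :
    lowerNorm B ≤ lowerNorm (B.comp p.subtypeL) :=
  le_lowerNorm fun x => lowerNorm_mul_norm_le B x

lemma recipNormInv_nonneg (B : V →L[ℂ] V) : 0 ≤ recipNormInv B := by
  unfold recipNormInv
  split_ifs <;> positivity

lemma recipNormInv_pos [Nontrivial V] {B : V →L[ℂ] V} (h : IsUnit B) : 0 < recipNormInv B := by
  rw [recipNormInv, if_pos h, Ring.inverse_of_isUnit h]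
  have : (↑h.unit⁻¹ : V →L[ℂ] V) ≠ 0 := Units.ne_zero _
  positivity

lemma recipNormInv_eq_lowerNorm [Nontrivial V] {B : V →L[ℂ] V} (h : IsUnit B) :
    recipNormInv B = lowerNorm B := by
  have hR := h
  obtain ⟨u, rfl⟩ := h
  rw [recipNormInv, if_pos hR, Ring.inverse_unit]
  have hpos : 0 < ‖(↑u⁻¹ : V →L[ℂ] V)‖ := norm_pos_iff.2 (Units.ne_zero _)
  have hl : ∀ x, (↑u⁻¹ : V →L[ℂ] V) ((u : V →L[ℂ] V) x) = x := fun x => by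
    rw [← mul_apply_eq_comp, Units.inv_mul, one_apply_eq_self]
  have hr : ∀ x, (u : V →L[ℂ] V) ((↑u⁻¹ : V →L[ℂ] V) x) = x := fun x => by
    rw [← mul_apply_eq_comp, Units.mul_inv, one_apply_eq_self]
  refine le_antisymm (le_lowerNorm fun x => ?_) ?_
  · have := (↑u⁻¹ : V →L[ℂ] V).le_opNorm ((u : V →L[ℂ] V) x)
    rw [hl] at this
    rw [one_div, ← div_eq_inv_mul, div_le_iff₀ hpos]
    linarith
  · rcases (lowerNorm_nonneg (u : V →L[ℂ] V)).eq_or_lt with h0 | h0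
    · rw [← h0]; positivity
    rw [le_one_div h0 hpos]
    refine ContinuousLinearMap.opNorm_le_bound _ (by positivity) fun x => ?_
    have := lowerNorm_mul_norm_le (u : V →L[ℂ] V) ((↑u⁻¹ : V →L[ℂ] V) x)
    rw [hr] at this
    rw [one_div, ← div_eq_inv_mul, le_div_iff₀ h0]
    linarith

lemma recipNormInv_conj [Nontrivial V] [Nontrivial W] (e : V ≃ₗᵢ[ℂ] W) (B : V →L[ℂ] V)
    (C : W →L[ℂ] W) (h : ∀ x, C (e x) = e (B x)) : recipNormInv C = recipNormInv B := by
  have hC : C = e.toContinuousLinearEquiv.conjContinuousAlgEquiv B := by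
    ext y
    obtain ⟨x, rfl⟩ := e.surjective y
    rw [h]
    simp
  have hu : IsUnit C ↔ IsUnit B := by
    rw [hC]
    exact MulEquiv.isUnit_map (e.toContinuousLinearEquiv.conjContinuousAlgEquiv (𝕜 := ℂ))
  have hn : lowerNorm C = lowerNorm B := by
    refine le_antisymm (le_lowerNorm fun x => ?_) (le_lowerNorm fun y => ?_)
    · have := lowerNorm_mul_norm_le C (e x)
      rwa [h, e.norm_map, e.norm_map] at this
    · obtain ⟨x, rfl⟩ := e.surjective y
      have := lowerNorm_mul_norm_le B x
      rwa [h, e.norm_map, e.norm_map]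
  by_cases hB : IsUnit B
  · rw [recipNormInv_eq_lowerNorm hB, recipNormInv_eq_lowerNorm (hu.2 hB), hn]
  · rw [recipNormInv, recipNormInv, if_neg hB, if_neg (mt hu.1 hB)]

end LowerNorm

/-! ### Invertibility in terms of an operator and its adjoint -/

section Adjoint

variable {Y : Type*} [NormedAddCommGroup Y] [NormedSpace ℂ Y]

instance [Nontrivial Y] : Nontrivial (EllTwo Y) := by
  obtain ⟨y, hy⟩ := exists_ne (0 : Y)
  refine ⟨⟨lp.single 2 0 y, 0, fun h => hy ?_⟩⟩
  have := congrArg (fun f : EllTwo Y => f 0) h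
  simpa using this

instance [Nontrivial Y] : Nontrivial (StrongDual ℂ Y) := by
  obtain ⟨y, hy⟩ := exists_ne (0 : Y)
  obtain ⟨g, -, hg⟩ := exists_dual_vector ℂ y (norm_ne_zero_iff.2 hy)
  refine ⟨⟨g, 0, fun h => hy ?_⟩⟩
  rw [h] at hg
  simpa using hg.symm

lemma adjoint_dualIso (B : EllTwo Y →L[ℂ] EllTwo Y) (f : StrongDual ℂ (EllTwo Y)) :
    adjoint B (dualIso Y f) = dualIso Y (f.comp B) := by
  simp [adjoint]

lemma adjoint_sub (B C : EllTwo Y →L[ℂ] EllTwo Y) :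
    adjoint (B - C) = adjoint B - adjoint C := by
  refine ContinuousLinearMap.ext fun φ => ?_
  obtain ⟨f, rfl⟩ := (dualIso Y).surjective φ
  rw [sub_apply, adjoint_dualIso, adjoint_dualIso, adjoint_dualIso,
    ContinuousLinearMap.comp_sub, map_sub]

lemma norm_adjoint_le (B : EllTwo Y →L[ℂ] EllTwo Y) : ‖adjoint B‖ ≤ ‖B‖ := by
  refine ContinuousLinearMap.opNorm_le_bound _ (norm_nonneg _) fun φ => ?_
  obtain ⟨f, rfl⟩ := (dualIso Y).surjective φ
  rw [adjoint_dualIso, LinearIsometryEquiv.norm_map, LinearIsometryEquiv.norm_map, mul_comm]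
  exact f.opNorm_comp_le B

/-- Each y is B x with ν(B)‖x‖ ≤ ‖y‖, so |f(y)| = |(f ∘ B)(x)| ≤ ‖f ∘ B‖‖y‖/ν(B). Thus for
invertible B the minimum of the two lower norms is ν(B). -/
lemma lowerNorm_le_adjoint [Nontrivial Y] {B : EllTwo Y →L[ℂ] EllTwo Y} (h : IsUnit B) :
    lowerNorm B ≤ lowerNorm (adjoint B) := by
  refine le_lowerNorm fun φ => ?_
  obtain ⟨f, rfl⟩ := (dualIso Y).surjective φ
  rw [adjoint_dualIso, LinearIsometryEquiv.norm_map, LinearIsometryEquiv.norm_map]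
  rcases (lowerNorm_nonneg B).eq_or_lt with h0 | h0
  · rw [← h0, zero_mul]; positivity
  rw [← le_div_iff₀' h0]
  refine ContinuousLinearMap.opNorm_le_bound _ (by positivity) fun y => ?_
  obtain ⟨u, rfl⟩ := h
  have hr : (u : EllTwo Y →L[ℂ] EllTwo Y) ((↑u⁻¹ : EllTwo Y →L[ℂ] EllTwo Y) y) = y := by
    rw [← mul_apply_eq_comp, Units.mul_inv, one_apply_eq_self]
  generalize (↑u⁻¹ : EllTwo Y →L[ℂ] EllTwo Y) y = x at hr
  subst hr
  refine ((f.comp (u : EllTwo Y →L[ℂ] EllTwo Y)).le_opNorm x).trans ?_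
  rw [div_mul_eq_mul_div, mul_div_assoc]
  gcongr
  rw [le_div_iff₀' h0]
  exact lowerNorm_mul_norm_le _ x

/-- A positive ν(B) makes B injective with closed range. Were the range proper, Hahn–Banach on the
quotient by it would give a nonzero functional f with f ∘ B = 0, contradicting ν(B*) > 0. -/
lemma isUnit_of_lowerNorm_pos [CompleteSpace Y] {B : EllTwo Y →L[ℂ] EllTwo Y}
    (h : 0 < lowerNorm B) (h' : 0 < lowerNorm (adjoint B)) : IsUnit B := by
  have hanti : AntilipschitzWith (Real.toNNReal (lowerNorm B)⁻¹) B :=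
    B.antilipschitz_of_bound fun x => by
      rw [Real.coe_toNNReal _ (by positivity), ← div_eq_inv_mul, le_div_iff₀' h]
      exact lowerNorm_mul_norm_le B x
  rw [ContinuousLinearMap.isUnit_iff_bijective]
  refine ⟨hanti.injective, ?_⟩
  by_contra hns
  rw [Function.Surjective] at hns
  push Not at hns
  obtain ⟨y, hy⟩ := hns
  have hcl : IsClosed (B.toLinearMap.range : Set (EllTwo Y)) := by
    rw [LinearMap.coe_range]
    exact hanti.isClosed_range B.uniformContinuous
  have : IsClosed (B.toLinearMap.range : Set (EllTwo Y)) := hcl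
  have hq : B.toLinearMap.range.mkQ y ≠ 0 := by
    rw [Submodule.mkQ_apply, Ne, Submodule.Quotient.mk_eq_zero]
    rintro ⟨x, hx⟩
    exact hy x hx
  obtain ⟨g, -, hg⟩ := exists_dual_vector ℂ _ (norm_ne_zero_iff.2 hq)
  set f : StrongDual ℂ (EllTwo Y) := g.comp B.toLinearMap.range.mkQL with hf
  have hfy : f y ≠ 0 := by
    change g (B.toLinearMap.range.mkQ y) ≠ 0
    rw [hg]
    simpa using hq
  have hfB : f.comp B = 0 := by
    ext x
    change g (B.toLinearMap.range.mkQ (B x)) = 0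
    have : B.toLinearMap.range.mkQ (B x) = 0 := by
      rw [Submodule.mkQ_apply, Submodule.Quotient.mk_eq_zero]
      exact ⟨x, rfl⟩
    rw [this, map_zero]
  have h1 := lowerNorm_mul_norm_le (adjoint B) (dualIso Y f)
  rw [adjoint_dualIso, hfB, map_zero, norm_zero, LinearIsometryEquiv.norm_map] at h1
  have h2 : 0 < ‖f‖ := norm_pos_iff.2 fun h0 => hfy (by rw [h0]; rfl)
  exact absurd h1 (not_le.2 (mul_pos h' h2))

theorem recipNormInv_eq_min [CompleteSpace Y] [Nontrivial Y] (B : EllTwo Y →L[ℂ] EllTwo Y) :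
    recipNormInv B = min (lowerNorm B) (lowerNorm (adjoint B)) := by
  by_cases hB : IsUnit B
  · rw [min_eq_left (lowerNorm_le_adjoint hB), recipNormInv_eq_lowerNorm hB]
  · rw [recipNormInv, if_neg hB]
    refine le_antisymm (le_min (lowerNorm_nonneg _) (lowerNorm_nonneg _)) (not_lt.1 fun h => hB ?_)
    exact isUnit_of_lowerNorm_pos (lt_min_iff.1 h).1 (lt_min_iff.1 h).2

/-- The formula through lower norms spares any case distinction on which of B and C are invertible.
-/
lemma recipNormInv_le_add [CompleteSpace Y] [Nontrivial Y] (B C : EllTwo Y →L[ℂ] EllTwo Y) :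
    recipNormInv B ≤ recipNormInv C + ‖B - C‖ := by
  rw [recipNormInv_eq_min, recipNormInv_eq_min, ← min_add_add_right]
  refine min_le_min (lowerNorm_le_add B C) ((lowerNorm_le_add (adjoint B) (adjoint C)).trans ?_)
  rw [← adjoint_sub]
  gcongr
  exact norm_adjoint_le _

end Adjoint

/-! ### Matrix representations -/

section Entries

variable {Y : Type*} [NormedAddCommGroup Y] [NormedSpace ℂ Y]

lemma hasSum_entry (B : EllTwo Y →L[ℂ] EllTwo Y) (x : EllTwo Y) (i : ℤ) :
    HasSum (fun j => entry B i j (x j)) (B x i) :=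
  (lp.hasSum_single (p := 2) (by norm_num) x).mapL ((coord i).comp B)

lemma norm_entry_le (B : EllTwo Y →L[ℂ] EllTwo Y) (i j : ℤ) : ‖entry B i j‖ ≤ ‖B‖ := by
  refine ContinuousLinearMap.opNorm_le_bound _ (norm_nonneg _) fun x => ?_
  change ‖(B (lp.single 2 j x)) i‖ ≤ _
  refine (lp.norm_apply_le_norm (by norm_num) _ i).trans ((B.le_opNorm _).trans_eq ?_)
  rw [lp.norm_single (by norm_num)]

lemma apply_eq_of_isBandedWith_one {B : EllTwo Y →L[ℂ] EllTwo Y} (hB : IsBandedWith B 1)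
    (x : EllTwo Y) (i : ℤ) :
    B x i = entry B i (i - 1) (x (i - 1)) + entry B i i (x i) + entry B i (i + 1) (x (i + 1)) := by
  have h : ∀ j ∉ ({i - 1, i, i + 1} : Finset ℤ), entry B i j (x j) = 0 := by
    intro j hj
    rw [hB i j, zero_apply]
    simp only [Finset.mem_insert, Finset.mem_singleton, not_or] at hj
    rw [lt_abs]
    push_cast
    omega
  rw [(hasSum_entry B x i).unique (hasSum_sum_of_ne_finset_zero h), Finset.sum_insert,
    Finset.sum_insert, Finset.sum_singleton, add_assoc]
  · simp
  · simp; omega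

lemma entry_sub_smul_id (B : EllTwo Y →L[ℂ] EllTwo Y) (z : ℂ) {i j : ℤ} (hij : i ≠ j) :
    entry (B - z • ContinuousLinearMap.id ℂ (EllTwo Y)) i j = entry B i j := by
  ext x
  change (B (lp.single 2 j x)) i - z • (lp.single 2 j x : EllTwo Y) i = (B (lp.single 2 j x)) i
  rw [lp.single_apply, Pi.single_eq_of_ne hij, smul_zero, sub_zero]

lemma IsBandedWith.sub_smul_id {B : EllTwo Y →L[ℂ] EllTwo Y} {w : ℕ} (hB : IsBandedWith B w)
    (z : ℂ) : IsBandedWith (B - z • ContinuousLinearMap.id ℂ (EllTwo Y)) w := by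
  intro i j hij
  rw [entry_sub_smul_id B z (by rintro rfl; simp at hij; omega), hB i j hij]

/-- The penalty sees only off-diagonal entries, so it is the same for all spectral parameters. -/
lemma penalty_sub_smul_id (n : ℕ) (B : EllTwo Y →L[ℂ] EllTwo Y) (z : ℂ) :
    penalty n (B - z • ContinuousLinearMap.id ℂ (EllTwo Y)) = penalty n B := by
  have h1 : ∀ i : ℤ, i + 1 ≠ i := fun i => by omega
  have h2 : ∀ i : ℤ, i - 1 ≠ i := fun i => by omega
  simp only [penalty, rBound, entry_sub_smul_id B z (h1 _), entry_sub_smul_id B z (h2 _)]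

lemma entry_adjoint_apply (B : EllTwo Y →L[ℂ] EllTwo Y) (i j : ℤ) (g : StrongDual ℂ Y) :
    entry (adjoint B) i j g = g.comp (entry B j i) := by
  ext x
  change pairing (lp.single 2 j g) (B (lp.single 2 i x)) = g ((B (lp.single 2 i x)) j)
  rw [pairing_apply, tsum_eq_single j]
  · simp
  · intro k hk
    simp [lp.single_apply, Pi.single_eq_of_ne hk]

lemma norm_entry_adjoint_le (B : EllTwo Y →L[ℂ] EllTwo Y) (i j : ℤ) :
    ‖entry (adjoint B) i j‖ ≤ ‖entry B j i‖ := by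
  refine ContinuousLinearMap.opNorm_le_bound _ (norm_nonneg _) fun g => ?_
  rw [entry_adjoint_apply, mul_comm]
  exact g.opNorm_comp_le _

lemma IsBandedWith.adjoint {B : EllTwo Y →L[ℂ] EllTwo Y} {w : ℕ} (hB : IsBandedWith B w) :
    IsBandedWith (adjoint B) w := by
  intro i j hij
  ext g : 1
  rw [entry_adjoint_apply, hB j i (by rwa [abs_sub_comm])]
  simp

lemma bddAbove_norm_entry (B : EllTwo Y →L[ℂ] EllTwo Y) (f g : ℤ → ℤ) :
    BddAbove (Set.range fun i => ‖entry B (f i) (g i)‖) :=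
  ⟨‖B‖, by rintro _ ⟨i, rfl⟩; exact norm_entry_le B _ _⟩

lemma rBound_nonneg (B : EllTwo Y →L[ℂ] EllTwo Y) : 0 ≤ rBound B :=
  add_nonneg (Real.iSup_nonneg fun _ => norm_nonneg _) (Real.iSup_nonneg fun _ => norm_nonneg _)

lemma rBound_le (B : EllTwo Y →L[ℂ] EllTwo Y) : rBound B ≤ 2 * ‖B‖ := by
  rw [two_mul]
  exact add_le_add (ciSup_le fun i => norm_entry_le B _ _) (ciSup_le fun i => norm_entry_le B _ _)

lemma sin_penalty_nonneg (n : ℕ) : 0 ≤ Real.sin (Real.pi / (2 * ((n : ℝ) + 1))) := by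
  have hn : (0 : ℝ) ≤ n := n.cast_nonneg
  refine Real.sin_nonneg_of_nonneg_of_le_pi (by positivity) (div_le_self Real.pi_pos.le ?_)
  linarith

lemma penalty_nonneg (n : ℕ) (B : EllTwo Y →L[ℂ] EllTwo Y) : 0 ≤ penalty n B :=
  mul_nonneg (mul_nonneg zero_le_two (rBound_nonneg B)) (sin_penalty_nonneg n)

end Entries

/-! ### The tridiagonal block form -/

section Blocks

variable {X : Type*} [NormedAddCommGroup X] [NormedSpace ℂ X]

instance [Nontrivial X] (b : ℕ) [NeZero b] : Nontrivial (Pow X b) := by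
  have : Nonempty (Fin b) := ⟨0⟩
  obtain ⟨x, hx⟩ := exists_ne (0 : X)
  refine ⟨⟨Pow.mk fun _ => x, Pow.mk fun _ => 0, fun h => hx ?_⟩⟩
  exact congrFun (congrArg Pow.get h) 0

lemma blockForm_blockIso (b : ℕ) [NeZero b] (B : EllTwo X →L[ℂ] EllTwo X) (x : EllTwo X) :
    blockForm b B (blockIso X b x) = blockIso X b (B x) := by
  simp [blockForm]

lemma blockForm_sub_smul_id (b : ℕ) [NeZero b] (B : EllTwo X →L[ℂ] EllTwo X) (z : ℂ) :
    blockForm b (B - z • ContinuousLinearMap.id ℂ (EllTwo X)) =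
      blockForm b B - z • ContinuousLinearMap.id ℂ (EllTwo (Pow X b)) := by
  refine ContinuousLinearMap.ext fun ξ => ?_
  obtain ⟨x, rfl⟩ := (blockIso X b).surjective ξ
  rw [blockForm_blockIso]
  simp [blockForm_blockIso]

lemma norm_blockForm_le (b : ℕ) [NeZero b] (B : EllTwo X →L[ℂ] EllTwo X) :
    ‖blockForm b B‖ ≤ ‖B‖ := by
  refine ContinuousLinearMap.opNorm_le_bound _ (norm_nonneg _) fun ξ => ?_
  obtain ⟨x, rfl⟩ := (blockIso X b).surjective ξ
  rw [blockForm_blockIso, LinearIsometryEquiv.norm_map, LinearIsometryEquiv.norm_map]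
  exact B.le_opNorm x

lemma recipNormInv_blockForm [Nontrivial X] (b : ℕ) [NeZero b] (B : EllTwo X →L[ℂ] EllTwo X) :
    recipNormInv (blockForm b B) = recipNormInv B :=
  recipNormInv_conj (blockIso X b) B _ (blockForm_blockIso b B)

theorem IsBandedWith.blockForm {b : ℕ} [NeZero b] {B : EllTwo X →L[ℂ] EllTwo X}
    (hB : IsBandedWith B b) : IsBandedWith (blockForm b B) 1 := by
  intro i j hij
  ext ξ : 1
  obtain ⟨x, hx⟩ := (blockIso X b).surjective (single j ξ)
  change (BandDominated.blockForm b B (single j ξ)) i = 0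
  rw [← hx, blockForm_blockIso]
  have hsupp : ∀ q : ℤ, ((blockIndex b).symm q).1 ≠ j → x q = 0 := by
    intro q hq
    have h1 : x = (blockIso X b).symm (single j ξ) := by rw [← hx]; simp
    rw [h1]
    change ((lp.single 2 j ξ : EllTwo (Pow X b)) _).get _ = 0
    rw [lp.single_apply, Pi.single_eq_of_ne hq]
    rfl
  have hz : ∀ m : Fin b, (B x) (blockIndex b (i, m)) = 0 := by
    intro m
    refine (hasSum_entry B x _).unique ?_
    convert hasSum_zero using 2 with q
    by_cases hq : ((blockIndex b).symm q).1 = j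
    · obtain ⟨⟨j', m'⟩, rfl⟩ := (blockIndex b).surjective q
      rw [Equiv.symm_apply_apply] at hq
      dsimp only at hq
      subst hq
      rw [hB, zero_apply]
      rw [blockIndex_apply, blockIndex_apply]
      have hm := m.2
      have hm' := m'.2
      have hb : (0 : ℤ) < b := by exact_mod_cast (NeZero.pos b)
      rw [lt_abs] at hij ⊢
      -- Blocks at least 2 apart contain only positions at distance at least 2b - (b - 1) = b + 1 >
      -- b.
      rcases hij with h | h
      · left
        have h2 : (2 : ℤ) ≤ i - j' := by push_cast at h; omega
        have := mul_le_mul_of_nonneg_left h2 hb.le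
        rw [mul_sub] at this
        omega
      · right
        have h2 : (2 : ℤ) ≤ j' - i := by push_cast at h; omega
        have := mul_le_mul_of_nonneg_left h2 hb.le
        rw [mul_sub] at this
        omega
    · rw [hsupp q hq, map_zero]
  change Pow.mk (fun m => (B x) (blockIndex b (i, m))) = 0
  simp only [hz]
  rfl

end Blocks

/-! ### Weighted windows -/

section Weights

/-- The discrete sine weights on `{1, …, n}` minimise the Rayleigh quotient of the discrete
Dirichlet Laplacian. -/
lemma exists_window_weight (n : ℕ) (hn : 0 < n) :
    ∃ (w : ℤ → ℝ) (S : ℝ), (∀ m : ℤ, ¬ (1 ≤ m ∧ m ≤ n) → w m = 0) ∧ 0 < S ∧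
      HasSum (fun m => w m ^ 2) S ∧
      HasSum (fun m => (w (m - 1) - w m) ^ 2)
        ((2 * Real.sin (Real.pi / (2 * ((n : ℝ) + 1)))) ^ 2 * S) ∧
      HasSum (fun m => (w (m + 1) - w m) ^ 2)
        ((2 * Real.sin (Real.pi / (2 * ((n : ℝ) + 1)))) ^ 2 * S) := by
  have hn0 : (0 : ℝ) < (n : ℝ) + 1 := by positivity
  set θ : ℝ := Real.pi / ((n : ℝ) + 1) with hθ
  have hθn : θ * ((n : ℝ) + 1) = Real.pi := by rw [hθ]; field_simp
  set w : ℤ → ℝ := fun m => if 1 ≤ m ∧ m ≤ n then Real.sin (θ * m) else 0 with hw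
  have hw0 : ∀ m : ℤ, ¬ (1 ≤ m ∧ m ≤ n) → w m = 0 := fun m hm => if_neg hm
  -- The sine vanishes at 0 and n + 1, so its formula extends one step beyond the support; this is
  -- what makes `hrec` hold at the end points.
  have hw1 : ∀ m : ℤ, 0 ≤ m → m ≤ n + 1 → w m = Real.sin (θ * m) := by
    intro m h0 h1
    by_cases hm : 1 ≤ m ∧ m ≤ n
    · exact if_pos hm
    rw [hw0 m hm]
    have : m = 0 ∨ m = n + 1 := by omega
    rcases this with rfl | rfl
    · simp
    · push_cast
      rw [hθn, Real.sin_pi]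
  have hrec : ∀ m : ℤ, w (m - 1) * w m + w m * w (m + 1) = 2 * Real.cos θ * w m ^ 2 := by
    intro m
    by_cases hm : 1 ≤ m ∧ m ≤ n
    · rw [hw1 m (by omega) (by omega), hw1 (m - 1) (by omega) (by omega),
        hw1 (m + 1) (by omega) (by omega)]
      push_cast
      rw [mul_sub, mul_add, mul_one, Real.sin_sub, Real.sin_add]
      ring
    · rw [hw0 m hm]; ring
  have hS : Summable fun m => w m ^ 2 :=
    summable_of_ne_finset_zero (s := Finset.Icc 1 (n : ℤ)) fun m hm => by
      rw [hw0 m (by simpa using hm)]; ring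
  have hC : Summable fun m => w m * w (m + 1) :=
    summable_of_ne_finset_zero (s := Finset.Icc 1 (n : ℤ)) fun m hm => by
      rw [hw0 m (by simpa using hm)]; ring
  obtain ⟨S, hS⟩ := hS
  obtain ⟨C, hC⟩ := hC
  have hC' : HasSum (fun m => w (m - 1) * w m) C := by
    have := (Equiv.subRight (1 : ℤ)).hasSum_iff.2 hC
    simpa [Function.comp_def] using this
  have hS' : HasSum (fun m => w (m + 1) ^ 2) S := by
    have := (Equiv.addRight (1 : ℤ)).hasSum_iff.2 hS
    simpa [Function.comp_def] using this
  -- Sum `hrec` over m: both products on its left are translates of the same series.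
  have hCS : C + C = 2 * Real.cos θ * S := by
    have h1 := hC'.add hC
    simp only [hrec] at h1
    exact h1.unique (hS.mul_left _)
  have hd : (2 * Real.sin (Real.pi / (2 * ((n : ℝ) + 1)))) ^ 2 = 2 - 2 * Real.cos θ := by
    have : θ = 2 * (Real.pi / (2 * ((n : ℝ) + 1))) := by rw [hθ]; field_simp
    rw [this, Real.cos_two_mul, mul_pow, Real.sin_sq]
    ring
  have hD : HasSum (fun m => (w (m + 1) - w m) ^ 2)
      ((2 * Real.sin (Real.pi / (2 * ((n : ℝ) + 1)))) ^ 2 * S) := by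
    have h1 := (hS'.add hS).sub (hC.mul_left 2)
    have h2 : (2 * Real.sin (Real.pi / (2 * ((n : ℝ) + 1)))) ^ 2 * S = S + S - 2 * C := by
      rw [hd]; linarith
    rw [h2]
    exact h1.congr_fun fun m => by ring
  refine ⟨w, S, hw0, ?_, hS, ?_, hD⟩
  · have h1 : 0 < w 1 := by
      rw [hw1 1 (by norm_num) (by omega), Int.cast_one, mul_one]
      refine Real.sin_pos_of_pos_of_lt_pi (by positivity) ?_
      rw [← hθn]
      have : (0 : ℝ) < n := by exact_mod_cast hn
      have hθ0 : 0 < θ := by positivity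
      nlinarith
    exact lt_of_lt_of_le (by positivity) (le_hasSum hS 1 fun m _ => sq_nonneg _)
  · have := (Equiv.subRight (1 : ℤ)).hasSum_iff.2 hD
    refine this.congr_fun fun m => ?_
    simp only [Function.comp_apply, Equiv.subRight_apply, sub_add_cancel]
    ring

/-- With p = (k, i), window offset k and position i, the shear (k, i) ↦ (i - k, i + a) separates the
weight from the vector. -/
lemma hasSum_diff_mul {u v : ℤ → ℝ} {U V : ℝ} (hu : HasSum u U) (hv : HasSum v V)
    (hu0 : ∀ i, 0 ≤ u i) (hv0 : ∀ i, 0 ≤ v i) (a : ℤ) :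
    HasSum (fun p : ℤ × ℤ => u (p.2 - p.1) * v (p.2 + a)) (U * V) := by
  have h := hu.mul hv (hu.summable.mul_of_nonneg hv.summable hu0 hv0)
  let e : ℤ × ℤ ≃ ℤ × ℤ :=
    { toFun := fun p => (p.2 - p.1, p.2 + a)
      invFun := fun q => (q.2 - a - q.1, q.2 - a)
      left_inv := fun p => by ext <;> dsimp only <;> ring
      right_inv := fun q => by ext <;> dsimp only <;> ring }
  exact e.hasSum_iff.2 h

/-- Cauchy–Schwarz with free weights. Choosing p, q, r as the sizes of the three terms makes the
final bound their sum. -/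
lemma add_add_sq_le {p q r : ℝ} (hp : 0 < p) (hq : 0 < q) (hr : 0 < r) (a b c : ℝ) :
    (a + b + c) ^ 2 ≤ (p + q + r) * (a ^ 2 / p + b ^ 2 / q + c ^ 2 / r) := by
  have h := Finset.sq_sum_div_le_sum_sq_div (Finset.univ : Finset (Fin 3)) ![a, b, c]
    (g := ![p, q, r]) (by intro i _; fin_cases i <;> simpa)
  simp only [Fin.sum_univ_three, Matrix.cons_val_zero, Matrix.cons_val_one,
    Matrix.cons_val_two] at h
  rwa [div_le_iff₀' (by positivity)] at h

variable {Y : Type*} [NormedAddCommGroup Y] [NormedSpace ℂ Y]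

/-- The sequence `x` multiplied by the translate of a weight supported in `{1, …, n}`. -/
def cutoff (n : ℕ) (w : ℤ → ℝ) (hw : ∀ m : ℤ, ¬ (1 ≤ m ∧ m ≤ n) → w m = 0) (k : ℤ)
    (x : EllTwo Y) : window Y n k :=
  ⟨⟨fun j => (w (j - k) : ℂ) • x j, (memℓp_two_iff _).2 <|
    summable_of_ne_finset_zero (s := Finset.Icc (k + 1) (k + n)) fun j hj => by
      rw [hw (j - k) (by simp only [Finset.mem_Icc] at hj; omega)]
      simp⟩,
    fun j hj => by
      change (w (j - k) : ℂ) • x j = 0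
      rw [hw (j - k) (by omega)]
      simp⟩

lemma norm_cutoff_apply {n : ℕ} {w : ℤ → ℝ} (hw : ∀ m : ℤ, ¬ (1 ≤ m ∧ m ≤ n) → w m = 0) (k : ℤ)
    (x : EllTwo Y) (j : ℤ) : ‖(cutoff n w hw k x : EllTwo Y) j‖ = |w (j - k)| * ‖x j‖ := by
  change ‖(w (j - k) : ℂ) • x j‖ = _
  rw [norm_smul, Complex.norm_real, Real.norm_eq_abs]

/-- B(wx) is w(Bx) plus a commutator; the diagonal of B commutes with w, so only differences of
neighbouring weights remain. -/
lemma norm_apply_cutoff_le {B : EllTwo Y →L[ℂ] EllTwo Y} (hB : IsBandedWith B 1) {α γ : ℝ}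
    (hα : ∀ i, ‖entry B i (i - 1)‖ ≤ α) (hγ : ∀ i, ‖entry B i (i + 1)‖ ≤ γ)
    {n : ℕ} {w : ℤ → ℝ} (hw : ∀ m : ℤ, ¬ (1 ≤ m ∧ m ≤ n) → w m = 0) (k : ℤ)
    (x : EllTwo Y) (i : ℤ) :
    ‖B (cutoff n w hw k x) i‖ ≤ |w (i - k)| * ‖B x i‖ +
      |w (i - k - 1) - w (i - k)| * (α * ‖x (i - 1)‖) +
      |w (i - k + 1) - w (i - k)| * (γ * ‖x (i + 1)‖) := by
  have hc : ∀ j, (cutoff n w hw k x : EllTwo Y) j = (w (j - k) : ℂ) • x j := fun _ => rfl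
  have h1 : B (cutoff n w hw k x) i = (w (i - k) : ℂ) • B x i +
      ((w (i - k - 1) - w (i - k) : ℝ) : ℂ) • entry B i (i - 1) (x (i - 1)) +
      ((w (i - k + 1) - w (i - k) : ℝ) : ℂ) • entry B i (i + 1) (x (i + 1)) := by
    rw [apply_eq_of_isBandedWith_one hB, apply_eq_of_isBandedWith_one hB x, hc, hc, hc,
      map_smul, map_smul, map_smul, show i - 1 - k = i - k - 1 by ring,
      show i + 1 - k = i - k + 1 by ring]
    push_cast
    module
  rw [h1]
  refine (norm_add₃_le).trans ?_
  rw [norm_smul, norm_smul, norm_smul, Complex.norm_real, Complex.norm_real, Complex.norm_real,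
    Real.norm_eq_abs, Real.norm_eq_abs, Real.norm_eq_abs]
  gcongr
  · exact (entry B i (i - 1)).le_of_opNorm_le (hα i) _
  · exact (entry B i (i + 1)).le_of_opNorm_le (hγ i) _

/-- Averaging over all windows: if every window had lower norm above c, summing the squared
estimates over k would exceed the total computed from the decoupled double sums. The slack in c is
needed because ν(B) need not be attained. -/
theorem exists_lowerNorm_window_le [Nontrivial Y] {B : EllTwo Y →L[ℂ] EllTwo Y}
    (hB : IsBandedWith B 1) {α γ : ℝ}
    (hα : ∀ i, ‖entry B i (i - 1)‖ ≤ α) (hγ : ∀ i, ‖entry B i (i + 1)‖ ≤ γ)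
    {n : ℕ} (hn : 0 < n) {c : ℝ}
    (hc : lowerNorm B + 2 * (α + γ) * Real.sin (Real.pi / (2 * ((n : ℝ) + 1))) < c) :
    ∃ k : ℤ, lowerNorm (B.comp (window Y n k).subtypeL) ≤ c := by
  obtain ⟨w, S, hw, hS0, hS, hD1, hD2⟩ := exists_window_weight n hn
  have hs := sin_penalty_nonneg n
  set d : ℝ := 2 * Real.sin (Real.pi / (2 * ((n : ℝ) + 1))) with hd
  have hd0 : 0 ≤ d := by positivity
  have hα0 : 0 ≤ α := (norm_nonneg _).trans (hα 0)
  have hγ0 : 0 ≤ γ := (norm_nonneg _).trans (hγ 0)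
  -- Adding η makes p, q, r positive, so they may serve as denominators even when ν(B), α or γ is 0;
  -- three copies of η still fit below c.
  obtain ⟨η, hη, hηc⟩ : ∃ η : ℝ, 0 < η ∧ (lowerNorm B + η) + (d * α + η) + (d * γ + η) < c := by
    refine ⟨(c - (lowerNorm B + d * (α + γ))) / 4, ?_, ?_⟩ <;> nlinarith
  have hν := lowerNorm_nonneg B
  obtain ⟨x, hx1, hxt⟩ := exists_norm_lt_of_lowerNorm_lt (B := B) (c := lowerNorm B + η)
    (by linarith)
  set p := lowerNorm B + η with hp
  set q := d * α + η with hq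
  set r := d * γ + η with hr
  have hp0 : 0 < p := by positivity
  have hq0 : 0 < q := by positivity
  have hr0 : 0 < r := by positivity
  have hx : HasSum (fun i => ‖x i‖ ^ 2) 1 := by
    have := (summable_norm_sq x).hasSum
    rwa [← norm_sq_eq_tsum, hx1, one_pow] at this
  have hBx : HasSum (fun i => ‖B x i‖ ^ 2) (‖B x‖ ^ 2) := by
    have := (summable_norm_sq (B x)).hasSum
    rwa [← norm_sq_eq_tsum] at this
  set F : ℤ × ℤ → ℝ := fun z => ‖B (cutoff n w hw z.1 x) z.2‖ ^ 2 with hF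
  have hG := ((((hasSum_diff_mul hS hBx (fun _ => sq_nonneg _) (fun _ => sq_nonneg _) 0).div_const
    p).add (((hasSum_diff_mul hD1 hx (fun _ => sq_nonneg _) (fun _ => sq_nonneg _)
    (-1)).mul_left (α ^ 2)).div_const q)).add (((hasSum_diff_mul hD2 hx (fun _ => sq_nonneg _)
    (fun _ => sq_nonneg _) 1).mul_left (γ ^ 2)).div_const r)).mul_left (p + q + r)
  have hFG : ∀ z, F z ≤ (p + q + r) * (w (z.2 - z.1) ^ 2 * ‖B x (z.2 + 0)‖ ^ 2 / p +
      α ^ 2 * ((w (z.2 - z.1 - 1) - w (z.2 - z.1)) ^ 2 * ‖x (z.2 + -1)‖ ^ 2) / q +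
      γ ^ 2 * ((w (z.2 - z.1 + 1) - w (z.2 - z.1)) ^ 2 * ‖x (z.2 + 1)‖ ^ 2) / r) := by
    rintro ⟨k, i⟩
    refine (pow_le_pow_left₀ (norm_nonneg _) (norm_apply_cutoff_le hB hα hγ hw k x i) 2).trans
      ((add_add_sq_le hp0 hq0 hr0 _ _ _).trans_eq ?_)
    dsimp only
    simp only [mul_pow, sq_abs, add_zero, ← sub_eq_add_neg]
    ring
  have hFs : Summable F := Summable.of_nonneg_of_le (fun _ => sq_nonneg _) hFG hG.summable
  have hFb : ∑' z, F z ≤ (p + q + r) ^ 2 * S := by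
    refine (hFs.tsum_le_tsum hFG hG.summable).trans ?_
    rw [hG.tsum_eq]
    have h1 : S * ‖B x‖ ^ 2 / p ≤ p * S := by
      rw [div_le_iff₀ hp0]
      have := pow_le_pow_left₀ (norm_nonneg (B x)) hxt.le 2
      nlinarith
    have h2 : α ^ 2 * (d ^ 2 * S * 1) / q ≤ q * S := by
      rw [div_le_iff₀ hq0]
      have := pow_le_pow_left₀ (by positivity) (show d * α ≤ q by linarith) 2
      nlinarith
    have h3 : γ ^ 2 * (d ^ 2 * S * 1) / r ≤ r * S := by
      rw [div_le_iff₀ hr0]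
      have := pow_le_pow_left₀ (by positivity) (show d * γ ≤ r by linarith) 2
      nlinarith
    have h4 := mul_le_mul_of_nonneg_left (add_le_add (add_le_add h1 h2) h3)
      (show 0 ≤ p + q + r by positivity)
    refine h4.trans_eq ?_
    ring
  -- The same double series summed over i first: its fibres are the squared norms of B on the
  -- cut-off vectors.
  have hFk : HasSum (fun k => ‖B (cutoff n w hw k x)‖ ^ 2) (∑' z, F z) := by
    refine hFs.hasSum.prod_fiberwise fun k => ?_
    rw [norm_sq_eq_tsum]
    exact (summable_norm_sq (B (cutoff n w hw k x))).hasSum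
  have hWk : HasSum (fun k => ‖(cutoff n w hw k x : EllTwo Y)‖ ^ 2) (S * 1) := by
    refine (hasSum_diff_mul hS hx (fun _ => sq_nonneg _) (fun _ => sq_nonneg _)
      0).prod_fiberwise fun k => ?_
    rw [norm_sq_eq_tsum]
    convert (summable_norm_sq (cutoff n w hw k x : EllTwo Y)).hasSum using 2 with j
    rw [norm_cutoff_apply hw, mul_pow, sq_abs, add_zero]
  have hc0 : 0 < c := by linarith
  by_contra! hcon
  have hle : ∀ k, c ^ 2 * ‖(cutoff n w hw k x : EllTwo Y)‖ ^ 2 ≤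
      ‖B (cutoff n w hw k x)‖ ^ 2 := by
    intro k
    rw [← mul_pow]
    refine pow_le_pow_left₀ (by positivity) ?_ 2
    exact (mul_le_mul_of_nonneg_right (hcon k).le (norm_nonneg _)).trans
      (lowerNorm_mul_norm_le (B.comp (window Y n k).subtypeL) (cutoff n w hw k x))
  have h1 := (hasSum_le hle (hWk.mul_left (c ^ 2)) hFk).trans hFb
  rw [mul_one] at h1
  have h2 : c ^ 2 ≤ (p + q + r) ^ 2 := le_of_mul_le_mul_right h1 hS0
  have h3 := pow_lt_pow_left₀ hηc (by positivity) two_ne_zero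
  linarith

end Weights

/-! ### The `τ₁` method for tridiagonal operators -/

section Truncation

variable {Y : Type*} [NormedAddCommGroup Y] [NormedSpace ℂ Y]

/-- For n = 0 there are no unit vectors and the real infimum over the empty set is 0, so restriction
could lower the lower norm. -/
lemma nontrivial_window [Nontrivial Y] {n : ℕ} (hn : 0 < n) (k : ℤ) :
    Nontrivial (window Y n k) := by
  obtain ⟨y, hy⟩ := exists_ne (0 : Y)
  refine ⟨⟨⟨lp.single 2 (k + 1) y, fun j hj => ?_⟩, 0, fun h => hy ?_⟩⟩
  · rw [lp.single_apply, Pi.single_eq_of_ne]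
    omega
  · have := congrArg (fun f : window Y n k => (f : EllTwo Y) (k + 1)) h
    simpa using this

lemma bddBelow_muTrunc (n : ℕ) (B : EllTwo Y →L[ℂ] EllTwo Y) :
    BddBelow (Set.range fun k : ℤ => min (lowerNorm (B.comp (window Y n k).subtypeL))
      (lowerNorm ((adjoint B).comp (window (StrongDual ℂ Y) n k).subtypeL))) :=
  ⟨0, by
    rintro _ ⟨k, rfl⟩
    exact le_min (lowerNorm_nonneg _) (lowerNorm_nonneg _)⟩

variable [CompleteSpace Y] [Nontrivial Y]

theorem recipNormInv_le_muTrunc {n : ℕ} (hn : 0 < n) (B : EllTwo Y →L[ℂ] EllTwo Y) :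
    recipNormInv B ≤ muTrunc n B := by
  rw [recipNormInv_eq_min]
  refine le_ciInf fun k => ?_
  have := nontrivial_window (Y := Y) hn k
  have := nontrivial_window (Y := StrongDual ℂ Y) hn k
  exact min_le_min (lowerNorm_le_comp_subtypeL _ _) (lowerNorm_le_comp_subtypeL _ _)

theorem muTrunc_le_recipNormInv_add_penalty {n : ℕ} (hn : 0 < n) {B : EllTwo Y →L[ℂ] EllTwo Y}
    (hB : IsBandedWith B 1) : muTrunc n B ≤ recipNormInv B + penalty n B := by
  set α := ⨆ i : ℤ, ‖entry B (i + 1) i‖ with hα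
  set γ := ⨆ i : ℤ, ‖entry B (i - 1) i‖ with hγ
  have h1 : ∀ i, ‖entry B (i + 1) i‖ ≤ α := le_ciSup (bddAbove_norm_entry B (· + 1) id)
  have h2 : ∀ i, ‖entry B (i - 1) i‖ ≤ γ := le_ciSup (bddAbove_norm_entry B (· - 1) id)
  have h1' : ∀ i, ‖entry B i (i - 1)‖ ≤ α := fun i => by simpa using h1 (i - 1)
  have h2' : ∀ i, ‖entry B i (i + 1)‖ ≤ γ := fun i => by simpa using h2 (i + 1)
  rw [recipNormInv_eq_min, ← min_add_add_right]
  refine le_min (le_of_forall_gt fun c hc => ?_) (le_of_forall_gt fun c hc => ?_)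
  · obtain ⟨c', hc', hcc⟩ := exists_between hc
    obtain ⟨k, hk⟩ := exists_lowerNorm_window_le hB h1' h2' hn hc'
    exact ((ciInf_le (bddBelow_muTrunc n B) k).trans ((min_le_left _ _).trans hk)).trans_lt hcc
  · obtain ⟨c', hc', hcc⟩ := exists_between hc
    -- Transposition exchanges the bounds α and γ; only their sum enters.
    obtain ⟨k, hk⟩ := exists_lowerNorm_window_le hB.adjoint
      (fun i => (norm_entry_adjoint_le B _ _).trans (h2 i))
      (fun i => (norm_entry_adjoint_le B _ _).trans (h1 i)) hn
      (c := c') (by rwa [add_comm γ α])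
    exact ((ciInf_le (bddBelow_muTrunc n B) k).trans ((min_le_right _ _).trans hk)).trans_lt hcc

end Truncation

/-! ### Pseudospectra -/

section Pseudospectra

variable {Y : Type*} [NormedAddCommGroup Y] [NormedSpace ℂ Y] [Nontrivial Y]

/-- On a nontrivial space an inverse is nonzero, so the value 0 occurs exactly at non-invertible
operators. This lets ε = 0 be treated like ε > 0. -/
lemma mem_spectrum_iff_recipNormInv {V : Type*} [NormedAddCommGroup V] [NormedSpace ℂ V]
    [Nontrivial V] (A : V →L[ℂ] V) (z : ℂ) :
    z ∈ spectrum ℂ A ↔ recipNormInv (A - z • ContinuousLinearMap.id ℂ V) = 0 := by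
  have h : algebraMap ℂ (V →L[ℂ] V) z - A = -(A - z • ContinuousLinearMap.id ℂ V) := by
    rw [neg_sub, Algebra.algebraMap_eq_smul_one]
    rfl
  rw [spectrum.mem_iff, h, IsUnit.neg_iff]
  refine ⟨fun hu => if_neg hu, fun h0 hu => (recipNormInv_pos hu).ne' h0⟩

lemma mem_Specc_iff {V : Type*} [NormedAddCommGroup V] [NormedSpace ℂ V]
    [Nontrivial V] (A : V →L[ℂ] V) {ε : ℝ} (hε : 0 ≤ ε) (z : ℂ) :
    z ∈ Specc ε A ↔ recipNormInv (A - z • ContinuousLinearMap.id ℂ V) ≤ ε := by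
  rcases hε.eq_or_lt with rfl | hε
  · rw [Specc, if_neg (lt_irrefl _), mem_spectrum_iff_recipNormInv]
    exact ⟨fun h => h.le, fun h => le_antisymm h (recipNormInv_nonneg _)⟩
  · rw [Specc, if_pos hε]
    rfl

variable [CompleteSpace Y]

lemma continuous_recipNormInv_sub_smul (A : EllTwo Y →L[ℂ] EllTwo Y) :
    Continuous fun z : ℂ => recipNormInv (A - z • ContinuousLinearMap.id ℂ (EllTwo Y)) := by
  have h : Continuous fun B : EllTwo Y →L[ℂ] EllTwo Y => recipNormInv B := by
    refine (LipschitzWith.of_le_add fun B C => ?_).continuous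
    rw [dist_eq_norm]
    exact recipNormInv_le_add B C
  exact h.comp (by fun_prop)

lemma isClosed_Specc (A : EllTwo Y →L[ℂ] EllTwo Y) {ε : ℝ} (hε : 0 ≤ ε) :
    IsClosed (Specc ε A) := by
  have : Specc ε A =
      {z : ℂ | recipNormInv (A - z • ContinuousLinearMap.id ℂ (EllTwo Y)) ≤ ε} :=
    Set.ext fun z => mem_Specc_iff A hε z
  rw [this]
  exact isClosed_le (continuous_recipNormInv_sub_smul A) continuous_const

lemma isBounded_Specc (A : EllTwo Y →L[ℂ] EllTwo Y) {ε : ℝ} (hε : 0 ≤ ε) :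
    Bornology.IsBounded (Specc ε A) := by
  refine (Metric.isBounded_closedBall (x := (0 : ℂ)) (r := ε + ‖A‖)).subset fun z hz => ?_
  rw [mem_closedBall_zero_iff]
  rcases le_or_gt ‖z‖ ‖A‖ with h | h
  · linarith
  have hspec : z ∉ spectrum ℂ A := fun hz' => by
    have := spectrum.norm_le_norm_of_mem hz'
    linarith
  rw [mem_spectrum_iff_recipNormInv] at hspec
  rw [mem_Specc_iff A hε] at hz
  have hu : IsUnit (A - z • ContinuousLinearMap.id ℂ (EllTwo Y)) := by
    by_contra hu
    exact hspec (if_neg hu)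
  rw [recipNormInv_eq_lowerNorm hu] at hz
  have h1 : ‖z‖ - ‖A‖ ≤ lowerNorm (A - z • ContinuousLinearMap.id ℂ (EllTwo Y)) := by
    refine le_lowerNorm fun x => ?_
    have h2 := norm_sub_norm_le (z • x) (A x)
    rw [norm_sub_rev, norm_smul] at h2
    have h3 := A.le_opNorm x
    change _ ≤ ‖A x - z • x‖
    linarith
  linarith

lemma Specc_mono {V : Type*} [NormedAddCommGroup V] [NormedSpace ℂ V]
    [Nontrivial V] (A : V →L[ℂ] V) {ε ε' : ℝ} (hε : 0 ≤ ε) (h : ε ≤ ε') :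
    Specc ε A ⊆ Specc ε' A := fun z hz =>
  (mem_Specc_iff A (hε.trans h) z).2 (((mem_Specc_iff A hε z).1 hz).trans h)

lemma nonempty_Specc (A : EllTwo Y →L[ℂ] EllTwo Y) {ε : ℝ} (hε : 0 ≤ ε) :
    (Specc ε A).Nonempty := by
  refine (spectrum.nonempty A).mono fun z hz => Specc_mono A le_rfl hε ?_
  rwa [Specc, if_neg (lt_irrefl _)]

/-- Right-continuity in ε: on the compact part of the (ε + 1)-pseudospectrum outside the thickening,
the continuous function 1/‖(A - z)⁻¹‖ attains a minimum, which exceeds ε. -/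
lemma exists_Specc_subset_thickening (A : EllTwo Y →L[ℂ] EllTwo Y) {ε e : ℝ} (hε : 0 ≤ ε)
    (he : 0 < e) : ∃ η > 0, Specc (ε + η) A ⊆ Metric.thickening e (Specc ε A) := by
  have hK : IsCompact (Specc (ε + 1) A \ Metric.thickening e (Specc ε A)) :=
    (Metric.isCompact_of_isClosed_isBounded (isClosed_Specc A (by positivity))
      (isBounded_Specc A (by positivity))).diff Metric.isOpen_thickening
  rcases (Specc (ε + 1) A \ Metric.thickening e (Specc ε A)).eq_empty_or_nonempty with h | h
  · exact ⟨1, one_pos, Set.sdiff_eq_empty.1 h⟩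
  obtain ⟨z₀, hz₀, hmin⟩ := hK.exists_isMinOn h (continuous_recipNormInv_sub_smul A).continuousOn
  have hz₁ : ε < recipNormInv (A - z₀ • ContinuousLinearMap.id ℂ (EllTwo Y)) := by
    by_contra! hle
    exact hz₀.2 (Metric.self_subset_thickening he _ ((mem_Specc_iff A hε z₀).2 hle))
  obtain ⟨c, hc, hc'⟩ := exists_between hz₁
  -- The 1 keeps z in the compact set; c - ε forces a value at most c, below the minimum.
  refine ⟨min 1 (c - ε), lt_min one_pos (sub_pos.2 hc), fun z hz => ?_⟩
  have hpos : 0 ≤ ε + min 1 (c - ε) := add_nonneg hε (le_min zero_le_one (sub_pos.2 hc).le)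
  by_contra hzt
  have h1 := hmin ⟨Specc_mono A hpos (by linarith [min_le_left 1 (c - ε)]) hz, hzt⟩
  have h2 := (mem_Specc_iff A hpos z).1 hz
  have h3 := min_le_right 1 (c - ε)
  simp only [Set.mem_ofPred_eq] at h1
  linarith

theorem hausdorffTendsto_Specc (A : EllTwo Y →L[ℂ] EllTwo Y) {ε : ℝ} (hε : 0 ≤ ε)
    {T : ℕ+ → Set ℂ} {η : ℕ+ → ℝ} (hη0 : ∀ n, 0 ≤ η n) (hη : Tendsto η atTop (𝓝 0))
    (h1 : ∀ n, Specc ε A ⊆ T n) (h2 : ∀ n, T n ⊆ Specc (ε + η n) A) :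
    HausdorffTendsto T (Specc ε A) := by
  refine ⟨fun n => ⟨(nonempty_Specc A hε).mono (h1 n),
    (isBounded_Specc A (add_nonneg hε (hη0 n))).subset (h2 n)⟩,
    nonempty_Specc A hε, isBounded_Specc A hε, ?_⟩
  rw [Metric.tendsto_atTop']
  intro e he
  obtain ⟨η₀, hη₀, hsub⟩ := exists_Specc_subset_thickening A hε (half_pos he)
  obtain ⟨N, hN⟩ := eventually_atTop.1 (hη.eventually_lt_const hη₀)
  refine ⟨N, fun n hn => ?_⟩
  rw [Real.dist_0_eq_abs, abs_of_nonneg Metric.hausdorffDist_nonneg]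
  refine (Metric.hausdorffDist_le_of_mem_dist (half_pos he).le (fun z hz => ?_)
    fun z hz => ⟨z, h1 n hz, by simpa using (half_pos he).le⟩).trans_lt (half_lt_self he)
  have hz' := hsub (Specc_mono A (add_nonneg hε (hη0 n)) (by linarith [hN n hn.le]) (h2 n hz))
  obtain ⟨y, hy, hd⟩ := Metric.mem_thickening_iff.1 hz'
  exact ⟨y, hy, hd.le⟩

end Pseudospectra

/-! ### Approximation by block tridiagonal operators -/

section Approximation

variable {X : Type*} [NormedAddCommGroup X] [NormedSpace ℂ X]

lemma tendsto_sin_penalty :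
    Tendsto (fun n : ℕ+ => Real.sin (Real.pi / (2 * (((n : ℕ) : ℝ) + 1)))) atTop (𝓝 0) := by
  have h1 : Tendsto (fun n : ℕ+ => (n : ℕ)) atTop atTop :=
    tendsto_atTop_mono' _ (Eventually.of_forall fun n => le_rfl) tendsto_PNat_val_atTop_atTop
  have h2 : Tendsto (fun n : ℕ+ => 2 * (((n : ℕ) : ℝ) + 1)) atTop atTop :=
    (tendsto_atTop_add_const_right _ 1
      (tendsto_natCast_atTop_atTop.comp h1)).const_mul_atTop two_pos
  have h3 := (Real.continuous_sin.tendsto 0).comp (h2.const_div_atTop Real.pi)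
  rwa [Real.sin_zero] at h3

/-- The block sizes are unrestricted, but 2 r(A_n) ≤ 4‖A^(n)‖ ≤ 4(‖A‖ + δ_n), and the sine factor
tends to 0. -/
lemma tendsto_penalty_blockForm (A : EllTwo X →L[ℂ] EllTwo X)
    (A' : ℕ+ → (EllTwo X →L[ℂ] EllTwo X)) (w : ℕ+ → ℕ+)
    (hδ : Tendsto (fun n => ‖A - A' n‖) atTop (𝓝 0)) :
    Tendsto (fun n : ℕ+ => penalty n (blockForm (w n) (A' n))) atTop (𝓝 0) := by
  have hub : Tendsto (fun n : ℕ+ => 4 * (‖A‖ + ‖A - A' n‖) *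
      Real.sin (Real.pi / (2 * (((n : ℕ) : ℝ) + 1)))) atTop (𝓝 0) := by
    have := ((hδ.const_add ‖A‖).const_mul 4).mul tendsto_sin_penalty
    rwa [mul_zero] at this
  refine squeeze_zero (fun n => penalty_nonneg _ _) (fun n => ?_) hub
  refine mul_le_mul_of_nonneg_right ?_ (sin_penalty_nonneg n)
  have h1 := rBound_le (blockForm (w n) (A' n))
  have h2 := norm_blockForm_le (w n) (A' n)
  have h3 := norm_sub_norm_le (A' n) A
  rw [norm_sub_rev] at h3
  linarith

variable [CompleteSpace X] [Nontrivial X]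

theorem Specc_subset_Gam_blockForm (A : EllTwo X →L[ℂ] EllTwo X) {B : EllTwo X →L[ℂ] EllTwo X}
    {b n : ℕ} [NeZero b] (hn : 0 < n) (hB : IsBandedWith B b) {ε : ℝ} (hε : 0 ≤ ε) :
    Specc ε A ⊆ Gam n (ε + ‖A - B‖ + penalty n (blockForm b B)) (blockForm b B) := by
  intro z hz
  rw [mem_Specc_iff A hε] at hz
  have h1 := muTrunc_le_recipNormInv_add_penalty hn (hB.blockForm.sub_smul_id z)
  rw [penalty_sub_smul_id, ← blockForm_sub_smul_id, recipNormInv_blockForm] at h1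
  have h2 := recipNormInv_le_add (B - z • ContinuousLinearMap.id ℂ (EllTwo X))
    (A - z • ContinuousLinearMap.id ℂ (EllTwo X))
  rw [sub_sub_sub_cancel_right, norm_sub_rev] at h2
  rw [blockForm_sub_smul_id] at h1
  change muTrunc n _ ≤ _
  linarith

theorem Gam_blockForm_subset_Specc (A B : EllTwo X →L[ℂ] EllTwo X)
    {b n : ℕ} [NeZero b] (hn : 0 < n) {ε : ℝ} (hε : 0 ≤ ε) :
    Gam n (ε + ‖A - B‖ + penalty n (blockForm b B)) (blockForm b B) ⊆
      Specc (ε + 2 * ‖A - B‖ + penalty n (blockForm b B)) A := by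
  intro z hz
  have hp := penalty_nonneg n (blockForm b B)
  rw [mem_Specc_iff A (by positivity)]
  have h1 := (recipNormInv_le_muTrunc hn _).trans
    (show muTrunc n (blockForm b B - z • ContinuousLinearMap.id ℂ (EllTwo (Pow X b))) ≤ _ from hz)
  rw [← blockForm_sub_smul_id, recipNormInv_blockForm] at h1
  have h2 := recipNormInv_le_add (A - z • ContinuousLinearMap.id ℂ (EllTwo X))
    (B - z • ContinuousLinearMap.id ℂ (EllTwo X))
  rw [sub_sub_sub_cancel_right] at h2
  linarith

end Approximation

end BandDominated

end

/-! ### The main theorem -/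

theorem theorem1p6 {X : Type*} [NormedAddCommGroup X] [NormedSpace ℂ X] [CompleteSpace X]
    [Nontrivial X] (hX : FiniteDimensional ℂ X ∨ IsHilbertNorm X)
    (A : EllTwo X →L[ℂ] EllTwo X) (hA : A ∈ BDO X)
    (A' : ℕ+ → (EllTwo X →L[ℂ] EllTwo X)) (w : ℕ+ → ℕ+)
    (hw : ∀ n, IsBandedWith (A' n) (w n))
    (hδ : Tendsto (fun n => ‖A - A' n‖) atTop (𝓝 0)) :
    (∀ n, IsBandedWith (blockForm (w n) (A' n)) 1) ∧
    (∀ ε : ℝ, 0 ≤ ε →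
      (∀ n : ℕ+,
        Specc ε A ⊆
          Gam n (ε + ‖A - A' n‖ + penalty n (blockForm (w n) (A' n))) (blockForm (w n) (A' n)) ∧
        Gam n (ε + ‖A - A' n‖ + penalty n (blockForm (w n) (A' n))) (blockForm (w n) (A' n)) ⊆
          Specc (ε + 2 * ‖A - A' n‖ + penalty n (blockForm (w n) (A' n))) A) ∧
      HausdorffTendsto
        (fun n => Gam n (ε + ‖A - A' n‖ + penalty n (blockForm (w n) (A' n)))
          (blockForm (w n) (A' n)))
        (Specc ε A)) ∧
    HausdorffTendsto
      (fun n => Gam n (‖A - A' n‖ + penalty n (blockForm (w n) (A' n)))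
        (blockForm (w n) (A' n)))
      (spectrum ℂ A) := by
  have hpen := tendsto_penalty_blockForm A A' w hδ
  have hconv : ∀ ε : ℝ, 0 ≤ ε → HausdorffTendsto
      (fun n => Gam n (ε + ‖A - A' n‖ + penalty n (blockForm (w n) (A' n)))
        (blockForm (w n) (A' n))) (Specc ε A) := by
    intro ε hε
    refine hausdorffTendsto_Specc A hε
      (η := fun n => 2 * ‖A - A' n‖ + penalty n (blockForm (w n) (A' n)))
      (fun n => add_nonneg (by positivity) (penalty_nonneg _ _)) ?_
      (fun n => Specc_subset_Gam_blockForm A n.pos (hw n) hε) fun n => ?_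
    · simpa using (hδ.const_mul 2).add hpen
    · rw [← add_assoc]
      exact Gam_blockForm_subset_Specc A (A' n) n.pos hε
  refine ⟨fun n => (hw n).blockForm, fun ε hε => ⟨fun n =>
    ⟨Specc_subset_Gam_blockForm A n.pos (hw n) hε, Gam_blockForm_subset_Specc A (A' n) n.pos hε⟩,
    hconv ε hε⟩, ?_⟩
  have h0 : Specc 0 A = spectrum ℂ A := if_neg (lt_irrefl _)
  simpa only [zero_add, h0] using hconv 0 le_rfl
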